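/- Let $L\ge 1$ be an integer, let $\alpha,T,\hat r>0$ be real, and let $(\varphi_i)_{i\ge0}$ be real numbers with $\varphi_0\neq 0$. Let $R_1,\dots,R_L$ be i.i.d. $\alpha$-$\mu$ mixtures, i.e. independent real random variables, each with PDF $$f(r)=\alpha\exp\!\Big(-\frac{r^{\alpha}}{\hat r^{\alpha}}\Big)\sum_{i=0}^{\infty}\frac{\varphi_i\,r^{\alpha(i+T)-1}}{\hat r^{\alpha(i+T)}\,\Gamma(i+T)}\quad(r>0),\qquad f(r)=0\quad(r\le 0),$$ where the series converges absolutely for every $r>0$. For $i\ge 0$ put $$\lambda_i=\frac{\Gamma(\alpha(i+T))}{\hat r^{\alpha i}}\sum_{j=0}^{i}\frac{(-1)^{i-j}\varphi_j}{(i-j)!\,\Gamma(j+T)},$$ and define $$\delta_0=\lambda_0^L,\qquad \delta_i=\frac{1}{i\lambda_0}\sum_{h=1}^{i}\delta_{i-h}\,\lambda_h\,(hL+h-i)\quad(i\ge1).$$ Then the sum $R=\sum_{\ell=1}^L R_\ell$ has PDF and CDF $$f_R(r)=\frac{\alpha^L}{\hat r^{\alpha TL}}\sum_{i=0}^{\infty}\frac{\delta_i\,r^{\alpha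 i+\alpha LT-1}}{\Gamma(\alpha i+\alpha LT)}\quad(r>0),\qquad F_R(r)=\frac{\alpha^L}{\hat r^{\alpha TL}}\sum_{i=0}^{\infty}\frac{\delta_i\,r^{\alpha i+\alpha LT}}{\Gamma(1+\alpha i+\alpha LT)}\quad(r\ge0),$$ with $f_R(r)=0$ for $r\le 0$, $F_R(r)=0$ for $r<0$, and both series converging absolutely. Moreover, these formulas are what the formulas for non-identically distributed summands reduce to. For parameters $T_\ell,\hat r_\ell>0$ and coefficients $\lambda_{i,\ell}$ (formed as above from $T_\ell,\hat r_\ell,\varphi_{i,\ell}$), the latter are $$\alpha^L\Big(\prod_{\ell=1}^L\frac{1}{\hat r_\ell^{\alpha T_\ell}}\Big)\sum_{i=0}^\infty\frac{\delta'_i\,r^{-1+\alpha i+\alpha\sum_\ell T_\ell}}{\Gamma(i\alpha+\alpha\sum_\ell T_\ell)},\qquad \alpha^L\Big(\prod_{\ell=1}^L\frac{1}{\hat r_\ell^{\alpha T_\ell}}\Big)\sum_{i=0}^\infty\frac{\delta'_i\,r^{\alpha i+\alpha\sum_\ell T_\ell}}{\Gamma(1+i\alpha+\alpha\sum_\ell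 T_\ell)},$$ where $\delta'_0=\prod_\ell\lambda_{0,\ell}$, $\delta'_i=\frac1i\sum_{h=1}^i\delta'_{i-h}\sum_{\ell=1}^L\phi_{h-1,\ell}$ for $i\ge1$, $\phi_{0,\ell}=\lambda_{1,\ell}/\lambda_{0,\ell}$, and $\phi_{h,\ell}=\frac1{\lambda_{0,\ell}}\big[(h+1)\lambda_{h+1,\ell}-\sum_{t=1}^h\lambda_{t,\ell}\,\phi_{h-t,\ell}\big]$ for $h\ge1$. If $T_\ell=T$, $\hat r_\ell=\hat r$ and $\varphi_{i,\ell}=\varphi_i$ for all $\ell$, then $\delta'_i=\delta_i$ for all $i\ge 0$, and the two expressions equal $f_R(r)$ for $r>0$ and $F_R(r)$ for $r\ge0$ respectively. -/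

import Mathlib

open MeasureTheory ProbabilityTheory

noncomputable section

namespace AlphaMu

/-- The real random variable `X` is continuous with probability density function `f`
(with respect to Lebesgue measure on the line). -/
def HasDensity {Ω : Type*} [MeasurableSpace Ω] (X : Ω → ℝ) (P : Measure Ω) (f : ℝ → ℝ) : Prop :=
  HasPDF X P volume ∧ (∀ᵐ r ∂(volume : Measure ℝ), 0 ≤ f r) ∧
    pdf X P volume =ᵐ[volume] fun r => ENNReal.ofReal (f r)

/-- The `i`-th term of the series in the density of an `α`-`μ` mixture. -/
def mixtureTerm (α T rhat : ℝ) (φ : ℕ → ℝ) (r : ℝ) (i : ℕ) : ℝ :=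
  φ i * r ^ (α * (i + T) - 1) / (rhat ^ (α * (i + T)) * Real.Gamma (i + T))

/-- The density of an `α`-`μ` mixture, extended by zero to the nonpositive half-line. -/
def mixturePDF (α T rhat : ℝ) (φ : ℕ → ℝ) (r : ℝ) : ℝ :=
  if 0 < r then α * Real.exp (-(r ^ α / rhat ^ α)) * ∑' i : ℕ, mixtureTerm α T rhat φ r i else 0

/-- `X` is an `α`-`μ` mixture: the series in its density converges absolutely on `(0, ∞)`,
and `X` has that density. -/
def IsMixture {Ω : Type*} [MeasurableSpace Ω] (X : Ω → ℝ) (P : Measure Ω)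
    (α T rhat : ℝ) (φ : ℕ → ℝ) : Prop :=
  (∀ r : ℝ, 0 < r → Summable (mixtureTerm α T rhat φ r)) ∧
    HasDensity X P (mixturePDF α T rhat φ)

/-- The coefficients `λ_i` of an `α`-`μ` mixture. -/
def lam (α T rhat : ℝ) (φ : ℕ → ℝ) (i : ℕ) : ℝ :=
  Real.Gamma (α * (i + T)) / rhat ^ (α * i) *
    ∑ j ∈ Finset.range (i + 1),
      (-1 : ℝ) ^ (i - j) * φ j / ((i - j).factorial * Real.Gamma (j + T))

/-- The auxiliary coefficients `φ_h` attached to one coefficient sequence `a`. -/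
def aux (a : ℕ → ℝ) : ℕ → ℝ
  | 0 => a 1 / a 0
  | h + 1 => 1 / a 0 * ((h + 2) * a (h + 2) - ∑ t : Fin (h + 1), a (t + 1) * aux a (h - t))
  termination_by h => h
  decreasing_by omega

theorem aux_zero (a : ℕ → ℝ) : aux a 0 = a 1 / a 0 := by rw [aux]

theorem aux_rec (a : ℕ → ℝ) (h : ℕ) (hh : 1 ≤ h) :
    aux a h = 1 / a 0 * ((h + 1) * a (h + 1) - ∑ t ∈ Finset.Icc 1 h, a t * aux a (h - t)) := by
  obtain ⟨k, rfl⟩ : ∃ k, h = k + 1 := ⟨h - 1, by omega⟩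
  rw [aux, Fin.sum_univ_eq_sum_range (fun t => a (t + 1) * aux a (k - t)),
    ← Finset.Ico_add_one_right_eq_Icc, Finset.sum_Ico_eq_sum_range]
  congr 2
  · push_cast
    ring
  · apply Finset.sum_congr rfl
    intro t _
    rw [show k + 1 - (1 + t) = k - t by omega, add_comm 1 t]

/-- The coefficients `δ_i` of the sum of independent, not necessarily identically distributed
mixtures, where `a ℓ` is the coefficient sequence of the `ℓ`-th summand. -/
def deltaInid {L : ℕ} (a : Fin L → ℕ → ℝ) : ℕ → ℝ
  | 0 => ∏ l, a l 0
  | i + 1 => 1 / ((i : ℝ) + 1) *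
      ∑ h : Fin (i + 1), deltaInid a (i - h) * ∑ l, aux (a l) h
  termination_by i => i
  decreasing_by omega

theorem deltaInid_zero {L : ℕ} (a : Fin L → ℕ → ℝ) : deltaInid a 0 = ∏ l, a l 0 := by
  rw [deltaInid]

theorem deltaInid_rec {L : ℕ} (a : Fin L → ℕ → ℝ) (i : ℕ) (hi : 1 ≤ i) :
    deltaInid a i =
      1 / (i : ℝ) * ∑ h ∈ Finset.Icc 1 i, deltaInid a (i - h) * ∑ l, aux (a l) (h - 1) := by
  obtain ⟨k, rfl⟩ : ∃ k, i = k + 1 := ⟨i - 1, by omega⟩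
  rw [deltaInid, Fin.sum_univ_eq_sum_range (fun h => deltaInid a (k - h) * ∑ l, aux (a l) h),
    ← Finset.Ico_add_one_right_eq_Icc, Finset.sum_Ico_eq_sum_range]
  congr 1
  · push_cast
    ring
  · apply Finset.sum_congr rfl
    intro t _
    rw [show k + 1 - (1 + t) = k - t by omega, show 1 + t - 1 = t by omega]

/-- The coefficients `δ_i` of the sum of `L` i.i.d. mixtures with coefficient sequence `a`. -/
def deltaIid (L : ℕ) (a : ℕ → ℝ) : ℕ → ℝ
  | 0 => a 0 ^ L
  | i + 1 => 1 / (((i : ℝ) + 1) * a 0) *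
      ∑ h : Fin (i + 1), deltaIid L a (i - h) * a (h + 1) *
        (((h : ℕ) + 1 : ℝ) * L + ((h : ℕ) + 1 : ℝ) - ((i : ℝ) + 1))
  termination_by i => i
  decreasing_by omega

theorem deltaIid_zero (L : ℕ) (a : ℕ → ℝ) : deltaIid L a 0 = a 0 ^ L := by
  rw [deltaIid]

theorem deltaIid_rec (L : ℕ) (a : ℕ → ℝ) (i : ℕ) (hi : 1 ≤ i) :
    deltaIid L a i = 1 / ((i : ℝ) * a 0) *
      ∑ h ∈ Finset.Icc 1 i, deltaIid L a (i - h) * a h * ((h : ℝ) * L + h - i) := by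
  obtain ⟨k, rfl⟩ : ∃ k, i = k + 1 := ⟨i - 1, by omega⟩
  rw [deltaIid, Fin.sum_univ_eq_sum_range (fun h => deltaIid L a (k - h) * a (h + 1) *
      (((h : ℕ) + 1 : ℝ) * L + ((h : ℕ) + 1 : ℝ) - ((k : ℝ) + 1))),
    ← Finset.Ico_add_one_right_eq_Icc, Finset.sum_Ico_eq_sum_range]
  congr 1
  · push_cast
    ring
  · apply Finset.sum_congr rfl
    intro t _
    rw [show k + 1 - (1 + t) = k - t by omega, add_comm 1 t]
    push_cast
    ring

/-- The `i`-th term of the density series of the sum of independent mixtures. -/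
def pdfTermInid {L : ℕ} (α : ℝ) (T rhat : Fin L → ℝ) (φ : Fin L → ℕ → ℝ) (r : ℝ) (i : ℕ) : ℝ :=
  deltaInid (fun l => lam α (T l) (rhat l) (φ l)) i * r ^ (-1 + α * i + α * ∑ l, T l) /
    Real.Gamma (i * α + α * ∑ l, T l)

/-- The `i`-th term of the distribution function series of the sum of independent mixtures. -/
def cdfTermInid {L : ℕ} (α : ℝ) (T rhat : Fin L → ℝ) (φ : Fin L → ℕ → ℝ) (r : ℝ) (i : ℕ) : ℝ :=
  deltaInid (fun l => lam α (T l) (rhat l) (φ l)) i * r ^ (α * i + α * ∑ l, T l) /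
    Real.Gamma (1 + i * α + α * ∑ l, T l)

/-- The general density formula for the sum of independent mixtures, at `r > 0`. -/
def pdfInid {L : ℕ} (α : ℝ) (T rhat : Fin L → ℝ) (φ : Fin L → ℕ → ℝ) (r : ℝ) : ℝ :=
  α ^ L * (∏ l, 1 / rhat l ^ (α * T l)) * ∑' i : ℕ, pdfTermInid α T rhat φ r i

/-- The general distribution function formula for the sum of independent mixtures, at `r ≥ 0`. -/
def cdfInid {L : ℕ} (α : ℝ) (T rhat : Fin L → ℝ) (φ : Fin L → ℕ → ℝ) (r : ℝ) : ℝ :=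
  α ^ L * (∏ l, 1 / rhat l ^ (α * T l)) * ∑' i : ℕ, cdfTermInid α T rhat φ r i

/-- The `i`-th term of the density series of the sum of `L` i.i.d. mixtures. -/
def pdfTermIid (L : ℕ) (α T rhat : ℝ) (φ : ℕ → ℝ) (r : ℝ) (i : ℕ) : ℝ :=
  deltaIid L (lam α T rhat φ) i * r ^ (-1 + α * i + α * L * T) /
    Real.Gamma (i * α + α * L * T)

/-- The `i`-th term of the distribution function series of the sum of `L` i.i.d. mixtures. -/
def cdfTermIid (L : ℕ) (α T rhat : ℝ) (φ : ℕ → ℝ) (r : ℝ) (i : ℕ) : ℝ :=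
  deltaIid L (lam α T rhat φ) i * r ^ (α * i + α * L * T) /
    Real.Gamma (1 + i * α + α * L * T)

/-- The density formula for the sum of `L` i.i.d. mixtures, at `r > 0`. -/
def pdfIid (L : ℕ) (α T rhat : ℝ) (φ : ℕ → ℝ) (r : ℝ) : ℝ :=
  α ^ L / rhat ^ (α * T * L) * ∑' i : ℕ, pdfTermIid L α T rhat φ r i

/-- The distribution function formula for the sum of `L` i.i.d. mixtures, at `r ≥ 0`. -/
def cdfIid (L : ℕ) (α T rhat : ℝ) (φ : ℕ → ℝ) (r : ℝ) : ℝ :=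
  α ^ L / rhat ^ (α * T * L) * ∑' i : ℕ, cdfTermIid L α T rhat φ r i

end AlphaMu

end

/-! ### Formal power series behind the coefficient recursions -/

namespace AlphaMu

open PowerSeries Finset

/-! The normalised powers `r ^ (s - 1) / Γ(s)` form a convolution semigroup in `s`, by the beta
integral. Hence convolving two series `∑ pᵢ r ^ (α i + A - 1) / Γ(α i + A)` multiplies the formal
power series `p` and adds the shifts `A` (`hasSum_gammaTerm_mul`). A mixture density is such a
series: the Cauchy product of `exp (-x)` with the series of the `φ i`, where `x = r ^ α / rhat ^ α`,
gives shift `α T` and `p = (α / rhat ^ (α T)) ∑ λᵢ Xⁱ` (`hasSum_gammaTerm_mixtureSeries`). So the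
sum of `L` independent copies has the series of `p ^ L`, and termwise integration gives the CDF.

Sums and integrals may be exchanged because the integral of the absolute value of the `(i, j)` term
is the product of the absolute terms at `r`, times `r * beta (α i + A) (α j + B)`, which is at most
`r * beta A B`.

The recursions are differential equations. `D = a ^ L` satisfies `a D' = L a' D`, which determines
`D` from `D 0` when `a 0 ≠ 0`; here `λ₀ ≠ 0` because `φ 0 ≠ 0`. The general recursion encodes `D' =
(∑ aₗ' / aₗ) D`, which for equal `aₗ` is the same equation. -/

/-- Coefficient form of `a D' = L a' D`. -/
theorem coeff_rec_of_derivative (L : ℕ) (a D : PowerSeries ℝ)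
    (h : a * d⁄dX ℝ D = L * (d⁄dX ℝ a * D)) (n : ℕ) :
    ((n : ℝ) + 1) * coeff 0 a * coeff (n + 1) D =
      ∑ k ∈ range (n + 1), coeff (n - k) D * coeff (k + 1) a *
        (((k : ℝ) + 1) * L + ((k : ℝ) + 1) - ((n : ℝ) + 1)) := by
  have hn := congrArg (coeff n) h
  rw [← map_natCast (C (R := ℝ)), coeff_C_mul, coeff_mul, coeff_mul,
    Nat.sum_antidiagonal_eq_sum_range_succ
      (fun i j => coeff i a * coeff j (d⁄dX ℝ D)),
    Nat.sum_antidiagonal_eq_sum_range_succ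
      (fun i j => coeff i (d⁄dX ℝ a) * coeff j D), sum_range_succ'] at hn
  simp only [coeff_derivative, Nat.sub_zero] at hn
  have h2 : ∑ k ∈ range (n + 1), coeff (n - k) D * coeff (k + 1) a * ((n : ℝ) - k) =
      ∑ k ∈ range n, coeff (k + 1) a *
        (coeff (n - (k + 1) + 1) D * (((n - (k + 1) : ℕ) : ℝ) + 1)) := by
    -- The factor `n - k` vanishes at `k = n`, so both ranges give the same sum.
    rw [sum_range_succ, sub_self, mul_zero, add_zero]
    refine sum_congr rfl fun k hk => ?_
    have hk := mem_range.1 hk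
    rw [show n - (k + 1) + 1 = n - k by omega, Nat.cast_sub (by omega : k + 1 ≤ n)]
    push_cast
    ring
  rw [← h2] at hn
  have h3 : ∑ k ∈ range (n + 1), coeff (n - k) D * coeff (k + 1) a *
        (((k : ℝ) + 1) * L + ((k : ℝ) + 1) - ((n : ℝ) + 1)) =
      L * ∑ k ∈ range (n + 1), coeff (k + 1) a * ((k : ℝ) + 1) * coeff (n - k) D -
      ∑ k ∈ range (n + 1), coeff (n - k) D * coeff (k + 1) a * ((n : ℝ) - k) := by
    rw [mul_sum, ← sum_sub_distrib]
    exact sum_congr rfl fun k _ => by ring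
  rw [h3, ← hn]
  ring

theorem deltaIid_eq_coeff (L : ℕ) (a : ℕ → ℝ) (ha : a 0 ≠ 0) (D : PowerSeries ℝ)
    (h0 : coeff 0 D = a 0 ^ L)
    (h : mk a * d⁄dX ℝ D = L * (d⁄dX ℝ (mk a) * D)) (i : ℕ) :
    deltaIid L a i = coeff i D := by
  induction i using Nat.strong_induction_on with
  | _ i ih =>
    cases i with
    | zero => rw [deltaIid_zero, h0]
    | succ n =>
      have hrec := coeff_rec_of_derivative L (mk a) D h n
      simp only [coeff_mk] at hrec
      rw [deltaIid, Fin.sum_univ_eq_sum_range (fun h => deltaIid L a (n - h) * a (h + 1) *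
        (((h : ℕ) + 1 : ℝ) * L + ((h : ℕ) + 1 : ℝ) - ((n : ℝ) + 1))),
        sum_congr rfl fun k _ => by rw [ih (n - k) (by omega)], ← hrec]
      have : (n : ℝ) + 1 ≠ 0 := by positivity
      field_simp

theorem deltaIid_eq_coeff_pow (L : ℕ) (a : ℕ → ℝ) (ha : a 0 ≠ 0) (i : ℕ) :
    deltaIid L a i = coeff i (mk a ^ L) := by
  refine deltaIid_eq_coeff L a ha _ (by simp) ?_ i
  rw [Derivation.leibniz_pow]
  -- The power rule contains the truncated exponent `L - 1`.
  cases L with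
  | zero => simp
  | succ n => simp only [Nat.add_sub_cancel, smul_eq_mul, nsmul_eq_mul]; ring

/-- The recursion for `aux a` is division of `a'` by `a`, coefficient by coefficient: `aux a` is the
logarithmic derivative. -/
theorem mk_mul_mk_aux (a : ℕ → ℝ) (ha : a 0 ≠ 0) :
    mk a * mk (aux a) = d⁄dX ℝ (mk a) := by
  ext n
  rw [coeff_mul, coeff_derivative,
    Nat.sum_antidiagonal_eq_sum_range_succ
      (fun i j => coeff i (mk a) * coeff j (mk (aux a))), sum_range_succ']
  simp only [coeff_mk, Nat.sub_zero]
  cases n with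
  | zero => simp [aux_zero]; field_simp
  | succ n =>
    rw [aux, Fin.sum_univ_eq_sum_range (fun t => a (t + 1) * aux a (n - t))]
    simp only [Nat.add_sub_add_right]
    push_cast
    field_simp
    ring

theorem derivative_mk_deltaInid {L : ℕ} (a : Fin L → ℕ → ℝ) :
    d⁄dX ℝ (mk (deltaInid a)) = (∑ l, mk (aux (a l))) * mk (deltaInid a) := by
  ext n
  rw [coeff_derivative, coeff_mul, Nat.sum_antidiagonal_eq_sum_range_succ
      (fun i j => coeff i (∑ l, mk (aux (a l))) * coeff j (mk (deltaInid a)))]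
  simp only [coeff_mk, map_sum]
  rw [deltaInid, Fin.sum_univ_eq_sum_range (fun h => deltaInid a (n - h) * ∑ l, aux (a l) h)]
  have : (n : ℝ) + 1 ≠ 0 := by positivity
  field_simp
  exact sum_congr rfl fun k _ => mul_comm _ _

/-- Multiplying `D' = L (a' / a) D` by `a` gives the equation that determines `deltaIid`; both start
at `a 0 ^ L`. -/
theorem deltaInid_const (L : ℕ) (a : ℕ → ℝ) (ha : a 0 ≠ 0) (i : ℕ) :
    deltaInid (fun _ : Fin L => a) i = deltaIid L a i := by
  rw [deltaIid_eq_coeff L a ha (mk (deltaInid fun _ : Fin L => a)) (by simp [deltaInid_zero]),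
    coeff_mk]
  rw [derivative_mk_deltaInid, sum_const, card_univ, Fintype.card_fin, nsmul_eq_mul,
    ← mk_mul_mk_aux a ha]
  ring

theorem pdfInid_const (L : ℕ) (α T rhat : ℝ) (hrhat : 0 < rhat) (φ : ℕ → ℝ)
    (ha : lam α T rhat φ 0 ≠ 0) (r : ℝ) :
    pdfInid α (fun _ : Fin L => T) (fun _ => rhat) (fun _ => φ) r = pdfIid L α T rhat φ r := by
  unfold pdfInid pdfIid pdfTermInid pdfTermIid
  simp only [deltaInid_const L _ ha, prod_const, sum_const, card_univ, Fintype.card_fin,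
    nsmul_eq_mul, mul_assoc]
  rw [← mul_assoc α T, Real.rpow_mul hrhat.le (α * T), Real.rpow_natCast, one_div, inv_pow]
  rw [div_eq_mul_inv, mul_assoc]

theorem cdfInid_const (L : ℕ) (α T rhat : ℝ) (hrhat : 0 < rhat) (φ : ℕ → ℝ)
    (ha : lam α T rhat φ 0 ≠ 0) (r : ℝ) :
    cdfInid α (fun _ : Fin L => T) (fun _ => rhat) (fun _ => φ) r = cdfIid L α T rhat φ r := by
  unfold cdfInid cdfIid cdfTermInid cdfTermIid
  simp only [deltaInid_const L _ ha, prod_const, sum_const, card_univ, Fintype.card_fin,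
    nsmul_eq_mul, mul_assoc]
  rw [← mul_assoc α T, Real.rpow_mul hrhat.le (α * T), Real.rpow_natCast, one_div, inv_pow]
  rw [div_eq_mul_inv, mul_assoc]

end AlphaMu

/-! ### Beta integrals and convolution of gamma series -/

namespace AlphaMu

open Set

theorem integral_rpow_mul_sub_rpow {p q x : ℝ} (hp : 0 < p) (hq : 0 < q) (hx : 0 < x) :
    ∫ y in Ioc 0 x, y ^ (p - 1) * (x - y) ^ (q - 1) = x ^ (p + q - 1) * beta p q := by
  have h := Complex.betaIntegral_scaled p q hx
  rw [Complex.betaIntegral_eq_Gamma_mul_div p q (by simpa) (by simpa),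
    intervalIntegral.integral_of_le hx.le] at h
  have h2 : ∫ y in Ioc 0 x, (y : ℂ) ^ ((p : ℂ) - 1) * ((x : ℂ) - y) ^ ((q : ℂ) - 1) =
      ∫ y in Ioc 0 x, ((y ^ (p - 1) * (x - y) ^ (q - 1) : ℝ) : ℂ) := by
    refine setIntegral_congr_fun measurableSet_Ioc fun y hy => ?_
    rw [Complex.ofReal_mul, Complex.ofReal_cpow hy.1.le, Complex.ofReal_cpow (sub_nonneg.2 hy.2)]
    push_cast
    rfl
  rw [h2, integral_complex_ofReal, ← Complex.ofReal_add, Complex.Gamma_ofReal, Complex.Gamma_ofReal,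
    Complex.Gamma_ofReal, ← Complex.ofReal_one, ← Complex.ofReal_sub,
    ← Complex.ofReal_cpow hx.le] at h
  exact_mod_cast h

theorem integrableOn_rpow_mul_sub_rpow {p q x : ℝ} (hp : 0 < p) (hq : 0 < q) (hx : 0 < x) :
    IntegrableOn (fun y => y ^ (p - 1) * (x - y) ^ (q - 1)) (Ioc 0 x) := by
  -- The Bochner integral of a non-integrable function is `0`, so the positive value just computed
  -- gives integrability.
  apply Integrable.of_integral_ne_zero
  rw [integral_rpow_mul_sub_rpow hp hq hx]
  exact (mul_pos (Real.rpow_pos_of_pos hx _) (beta_pos hp hq)).ne'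

/-- On `(0, 1)` both powers in the beta integrand decrease as their exponents grow. This gives the
bound uniform in `(i, j)` for the double series. -/
theorem beta_anti {p q p' q' : ℝ} (hp : 0 < p) (hq : 0 < q) (hpp : p ≤ p') (hqq : q ≤ q') :
    beta p' q' ≤ beta p q := by
  have h := integral_rpow_mul_sub_rpow hp hq one_pos
  have h' := integral_rpow_mul_sub_rpow (hp.trans_le hpp) (hq.trans_le hqq) one_pos
  rw [Real.one_rpow, one_mul, integral_Ioc_eq_integral_Ioo] at h h'
  rw [← h, ← h']
  refine setIntegral_mono_on
    ((integrableOn_rpow_mul_sub_rpow (hp.trans_le hpp) (hq.trans_le hqq) one_pos).mono_set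
      Ioo_subset_Ioc_self)
    ((integrableOn_rpow_mul_sub_rpow hp hq one_pos).mono_set Ioo_subset_Ioc_self)
    measurableSet_Ioo fun y hy => ?_
  exact mul_le_mul (Real.rpow_le_rpow_of_exponent_ge hy.1 hy.2.le (by linarith))
    (Real.rpow_le_rpow_of_exponent_ge (sub_pos.2 hy.2) (by linarith [hy.1]) (by linarith))
    (Real.rpow_nonneg (sub_nonneg.2 hy.2.le) _) (Real.rpow_nonneg hy.1.le _)

/-- If the integrals of the norms are summable, the sum of the series is integrable. -/
theorem integrable_tsum_of_summable_integral_norm {ι X : Type*} [Countable ι] [MeasurableSpace X]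
    {μ : Measure X} {F : ι → X → ℝ} (hm : ∀ i, Measurable (F i)) (hF : ∀ i, Integrable (F i) μ)
    (hs : Summable fun i => ∫ a, ‖F i a‖ ∂μ) : Integrable (fun a => ∑' i, F i a) μ := by
  refine ⟨(Measurable.tsum hm).aestronglyMeasurable, ?_⟩
  have h1 : ∫⁻ a, ‖∑' i, F i a‖ₑ ∂μ ≤ ∑' i, ∫⁻ a, ‖F i a‖ₑ ∂μ := by
    rw [← lintegral_tsum fun i => (hm i).enorm.aemeasurable]
    exact lintegral_mono fun a => enorm_tsum_le_tsum_enorm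
  refine h1.trans_lt ?_
  have h2 : ∀ i, ∫⁻ a, ‖F i a‖ₑ ∂μ = ENNReal.ofReal (∫ a, ‖F i a‖ ∂μ) := fun i => by
    rw [ofReal_integral_norm_eq_lintegral_enorm (hF i)]
  simp only [h2]
  exact hs.tsum_ofReal_lt_top

/-- The `i`-th term of the series `∑ pᵢ r ^ (α i + A - 1) / Γ(α i + A)`. -/
noncomputable def gammaTerm (α A : ℝ) (p : PowerSeries ℝ) (r : ℝ) (i : ℕ) : ℝ :=
  PowerSeries.coeff i p * r ^ (α * i + A - 1) / Real.Gamma (α * i + A)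

/-- The sum of the series with terms `gammaTerm` on the positive half-line, extended by zero. -/
noncomputable def gammaSeries (α A : ℝ) (p : PowerSeries ℝ) (r : ℝ) : ℝ :=
  if 0 < r then ∑' i, gammaTerm α A p r i else 0

theorem measurable_gammaTerm (α A : ℝ) (p : PowerSeries ℝ) (i : ℕ) :
    Measurable fun r => gammaTerm α A p r i := by
  unfold gammaTerm
  fun_prop

section Convolution

variable {α A B : ℝ} {p q : PowerSeries ℝ}

theorem gammaTerm_mul_gammaTerm (r y : ℝ) (i j : ℕ) :
    gammaTerm α A p y i * gammaTerm α B q (r - y) j =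
      PowerSeries.coeff i p * PowerSeries.coeff j q /
        (Real.Gamma (α * i + A) * Real.Gamma (α * j + B)) *
        (y ^ (α * i + A - 1) * (r - y) ^ (α * j + B - 1)) := by
  unfold gammaTerm
  rw [div_mul_div_comm]
  ring

theorem integrableOn_gammaTerm_mul (hα : 0 < α) (hA : 0 < A) (hB : 0 < B) {r : ℝ} (hr : 0 < r)
    (i j : ℕ) :
    IntegrableOn (fun y => gammaTerm α A p y i * gammaTerm α B q (r - y) j) (Ioc 0 r) := by
  simp only [gammaTerm_mul_gammaTerm]
  exact (integrableOn_rpow_mul_sub_rpow (by positivity) (by positivity) hr).const_mul _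

theorem integral_gammaTerm_mul (hα : 0 < α) (hA : 0 < A) (hB : 0 < B) {r : ℝ} (hr : 0 < r)
    (i j : ℕ) :
    ∫ y in Ioc 0 r, gammaTerm α A p y i * gammaTerm α B q (r - y) j =
      PowerSeries.coeff i p * PowerSeries.coeff j q * r ^ (α * (i + j : ℕ) + (A + B) - 1) /
        Real.Gamma (α * (i + j : ℕ) + (A + B)) := by
  simp only [gammaTerm_mul_gammaTerm]
  rw [integral_const_mul, integral_rpow_mul_sub_rpow (by positivity) (by positivity) hr, beta,
    show α * i + A + (α * j + B) = α * (i + j : ℕ) + (A + B) by push_cast; ring]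
  have h1 : Real.Gamma (α * i + A) ≠ 0 := (Real.Gamma_pos_of_pos (by positivity)).ne'
  have h2 : Real.Gamma (α * j + B) ≠ 0 := (Real.Gamma_pos_of_pos (by positivity)).ne'
  field_simp

/-- Writing the value through the terms at the endpoint `r` lets summability at `r` control the
double series. -/
theorem integral_norm_gammaTerm_mul (hα : 0 < α) (hA : 0 < A) (hB : 0 < B) {r : ℝ} (hr : 0 < r)
    (i j : ℕ) :
    ∫ y in Ioc 0 r, ‖gammaTerm α A p y i * gammaTerm α B q (r - y) j‖ =
      ‖gammaTerm α A p r i‖ * ‖gammaTerm α B q r j‖ * (r * beta (α * i + A) (α * j + B)) := by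
  have h1 : 0 < Real.Gamma (α * i + A) := Real.Gamma_pos_of_pos (by positivity)
  have h2 : 0 < Real.Gamma (α * j + B) := Real.Gamma_pos_of_pos (by positivity)
  simp only [gammaTerm_mul_gammaTerm]
  have h3 : ∀ y ∈ Ioc 0 r, ‖PowerSeries.coeff i p * PowerSeries.coeff j q /
        (Real.Gamma (α * i + A) * Real.Gamma (α * j + B)) *
        (y ^ (α * i + A - 1) * (r - y) ^ (α * j + B - 1))‖ =
      |PowerSeries.coeff i p| * |PowerSeries.coeff j q| /
        (Real.Gamma (α * i + A) * Real.Gamma (α * j + B)) *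
        (y ^ (α * i + A - 1) * (r - y) ^ (α * j + B - 1)) := fun y hy => by
    rw [norm_mul, norm_div, norm_mul, Real.norm_of_nonneg (mul_pos h1 h2).le,
      Real.norm_of_nonneg (mul_nonneg (Real.rpow_nonneg hy.1.le _)
        (Real.rpow_nonneg (sub_nonneg.2 hy.2) _))]
    rfl
  rw [setIntegral_congr_fun measurableSet_Ioc h3, integral_const_mul,
    integral_rpow_mul_sub_rpow (by positivity) (by positivity) hr,
    show α * i + A + (α * j + B) - 1 = (α * i + A - 1) + (α * j + B - 1) + 1 by ring,
    Real.rpow_add hr, Real.rpow_add hr, Real.rpow_one]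
  simp only [gammaTerm, norm_div, norm_mul, Real.norm_of_nonneg h1.le, Real.norm_of_nonneg h2.le,
    Real.norm_of_nonneg (Real.rpow_nonneg hr.le _)]
  simp only [Real.norm_eq_abs]
  field_simp

theorem summable_integral_norm_gammaTerm_mul (hα : 0 < α) (hA : 0 < A) (hB : 0 < B)
    {r : ℝ} (hr : 0 < r) (hp : Summable (gammaTerm α A p r)) (hq : Summable (gammaTerm α B q r)) :
    Summable fun ij : ℕ × ℕ =>
      ∫ y in Ioc 0 r, ‖gammaTerm α A p y ij.1 * gammaTerm α B q (r - y) ij.2‖ := by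
  simp only [integral_norm_gammaTerm_mul hα hA hB hr]
  refine Summable.of_nonneg_of_le (fun ij => ?_) (fun ij => ?_)
    ((hp.norm.mul_of_nonneg hq.norm (fun _ => norm_nonneg _) fun _ => norm_nonneg _).mul_right
      (r * beta A B))
  · have := beta_pos (α := α * ij.1 + A) (β := α * ij.2 + B) (by positivity) (by positivity)
    positivity
  · have := beta_anti hA hB (p' := α * ij.1 + A) (q' := α * ij.2 + B)
      (le_add_of_nonneg_left (by positivity)) (le_add_of_nonneg_left (by positivity))
    gcongr

theorem tsum_gammaTerm_mul {r y : ℝ} (hp : Summable (gammaTerm α A p y))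
    (hq : Summable (gammaTerm α B q (r - y))) :
    ∑' ij : ℕ × ℕ, gammaTerm α A p y ij.1 * gammaTerm α B q (r - y) ij.2 =
      (∑' i, gammaTerm α A p y i) * ∑' j, gammaTerm α B q (r - y) j :=
  (tsum_mul_tsum_of_summable_norm hp.norm hq.norm).symm

/-- The convolution of two gamma series is the gamma series of the Cauchy product. -/
theorem hasSum_gammaTerm_mul (hα : 0 < α) (hA : 0 < A) (hB : 0 < B)
    (hp : ∀ r, 0 < r → Summable (gammaTerm α A p r))
    (hq : ∀ r, 0 < r → Summable (gammaTerm α B q r)) {r : ℝ} (hr : 0 < r) :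
    HasSum (gammaTerm α (A + B) (p * q) r)
      (∫ y in Ioo 0 r, gammaSeries α A p y * gammaSeries α B q (r - y)) := by
  have h := hasSum_integral_of_summable_integral_norm
    (fun ij : ℕ × ℕ => integrableOn_gammaTerm_mul (p := p) (q := q) hα hA hB hr ij.1 ij.2)
    (summable_integral_norm_gammaTerm_mul hα hA hB hr (hp r hr) (hq r hr))
  -- At `y = r` the second argument is `0`, where `gammaSeries` is set to `0`; the open interval
  -- avoids this.
  rw [integral_Ioc_eq_integral_Ioo, setIntegral_congr_fun measurableSet_Ioo fun y hy =>
    show _ = gammaSeries α A p y * gammaSeries α B q (r - y) by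
      rw [gammaSeries, gammaSeries, if_pos hy.1, if_pos (sub_pos.2 hy.2)]
      exact tsum_gammaTerm_mul (hp y hy.1) (hq _ (sub_pos.2 hy.2))] at h
  simp only [integral_gammaTerm_mul hα hA hB hr] at h
  -- Apart from the coefficients, the integrated terms depend only on `i + j`, so regrouping along
  -- antidiagonals produces the coefficients of `p * q`.
  rw [← Finset.HasAntidiagonal.sigmaAntidiagonalEquivProd.hasSum_iff] at h
  refine h.sigma fun n => ?_
  convert hasSum_fintype _ using 1
  rw [gammaTerm, PowerSeries.coeff_mul, Finset.sum_mul, Finset.sum_div,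
    ← Finset.sum_coe_sort]
  refine Finset.sum_congr rfl fun ij _ => ?_
  simp only [Function.comp_apply, Finset.HasAntidiagonal.sigmaAntidiagonalEquivProd_apply]
  rw [Finset.HasAntidiagonal.mem_antidiagonal.1 ij.2]

theorem integrableOn_gammaSeries_mul (hα : 0 < α) (hA : 0 < A) (hB : 0 < B)
    (hp : ∀ r, 0 < r → Summable (gammaTerm α A p r))
    (hq : ∀ r, 0 < r → Summable (gammaTerm α B q r)) {r : ℝ} (hr : 0 < r) :
    IntegrableOn (fun y => gammaSeries α A p y * gammaSeries α B q (r - y)) (Ioo 0 r) := by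
  have h := integrable_tsum_of_summable_integral_norm
    (fun ij : ℕ × ℕ => (measurable_gammaTerm α A p ij.1).mul
      ((measurable_gammaTerm α B q ij.2).comp (measurable_const.sub measurable_id)))
    (fun ij : ℕ × ℕ => integrableOn_gammaTerm_mul (p := p) (q := q) hα hA hB hr ij.1 ij.2)
    (summable_integral_norm_gammaTerm_mul hα hA hB hr (hp r hr) (hq r hr))
  refine (IntegrableOn.mono_set h Ioo_subset_Ioc_self).congr_fun (fun y hy => ?_) measurableSet_Ioo
  rw [gammaSeries, gammaSeries, if_pos hy.1, if_pos (sub_pos.2 hy.2)]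
  exact tsum_gammaTerm_mul (hp y hy.1) (hq _ (sub_pos.2 hy.2))

end Convolution

end AlphaMu

/-! ### Densities of independent sums and distribution functions -/

namespace AlphaMu

open Set

theorem ae_nonneg_comp_sub {f : ℝ → ℝ} (hf : ∀ᵐ r, 0 ≤ f r) (x : ℝ) : ∀ᵐ y, 0 ≤ f (x - y) :=
  (Measure.measurePreserving_sub_left volume x).quasiMeasurePreserving.ae hf

section Convolution

variable {α A B : ℝ} {p q : PowerSeries ℝ}

theorem gammaSeries_of_pos {r : ℝ} (hr : 0 < r) :
    gammaSeries α A p r = ∑' i, gammaTerm α A p r i := if_pos hr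

theorem gammaSeries_of_nonpos {r : ℝ} (hr : r ≤ 0) : gammaSeries α A p r = 0 :=
  if_neg hr.not_gt

theorem gammaSeries_mul_of_pos (hα : 0 < α) (hA : 0 < A) (hB : 0 < B)
    (hp : ∀ r, 0 < r → Summable (gammaTerm α A p r))
    (hq : ∀ r, 0 < r → Summable (gammaTerm α B q r)) {r : ℝ} (hr : 0 < r) :
    gammaSeries α (A + B) (p * q) r =
      ∫ y in Ioo 0 r, gammaSeries α A p y * gammaSeries α B q (r - y) := by
  rw [gammaSeries_of_pos hr, (hasSum_gammaTerm_mul hα hA hB hp hq hr).tsum_eq]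

/-- The convolution integral ignores null sets, so nonnegativity almost everywhere of the factors
gives it at every point. -/
theorem gammaSeries_mul_nonneg (hα : 0 < α) (hA : 0 < A) (hB : 0 < B)
    (hp : ∀ r, 0 < r → Summable (gammaTerm α A p r))
    (hq : ∀ r, 0 < r → Summable (gammaTerm α B q r))
    (hp0 : ∀ᵐ r, 0 ≤ gammaSeries α A p r) (hq0 : ∀ᵐ r, 0 ≤ gammaSeries α B q r) (r : ℝ) :
    0 ≤ gammaSeries α (A + B) (p * q) r := by
  rcases le_or_gt r 0 with hr | hr
  · rw [gammaSeries_of_nonpos hr]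
  · rw [gammaSeries_mul_of_pos hα hA hB hp hq hr]
    refine integral_nonneg_of_ae (ae_restrict_of_ae ?_)
    filter_upwards [hp0, ae_nonneg_comp_sub hq0 r] with y h1 h2 using mul_nonneg h1 h2

/-- Extension by zero confines the integrand to `0 < y < r`; there, nonnegativity and integrability
identify the Lebesgue and Bochner integrals. -/
theorem lconvolution_gammaSeries (hα : 0 < α) (hA : 0 < A) (hB : 0 < B)
    (hp : ∀ r, 0 < r → Summable (gammaTerm α A p r))
    (hq : ∀ r, 0 < r → Summable (gammaTerm α B q r))
    (hp0 : ∀ᵐ r, 0 ≤ gammaSeries α A p r) (hq0 : ∀ᵐ r, 0 ≤ gammaSeries α B q r) (r : ℝ) :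
    ∫⁻ y, ENNReal.ofReal (gammaSeries α A p y) * ENNReal.ofReal (gammaSeries α B q (r - y)) =
      ENNReal.ofReal (gammaSeries α (A + B) (p * q) r) := by
  have h0 : ∀ y ∉ Ioo 0 r, ENNReal.ofReal (gammaSeries α A p y) *
      ENNReal.ofReal (gammaSeries α B q (r - y)) = 0 := fun y hy => by
    rcases le_or_gt y 0 with h | h
    · simp [gammaSeries_of_nonpos h]
    · rw [gammaSeries_of_nonpos (r := r - y)
        (sub_nonpos.2 (not_lt.1 fun h' => hy ⟨h, h'⟩))]
      simp
  rw [← setLIntegral_eq_of_support_subset (s := Ioo 0 r) fun y hy => by_contra fun h => hy (h0 y h)]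
  rcases le_or_gt r 0 with hr | hr
  · simp [gammaSeries_of_nonpos hr, Ioo_eq_empty hr.not_gt]
  · rw [gammaSeries_mul_of_pos hα hA hB hp hq hr, ofReal_integral_eq_lintegral_ofReal
      (integrableOn_gammaSeries_mul hα hA hB hp hq hr)]
    · refine lintegral_congr_ae (ae_restrict_of_ae ?_)
      filter_upwards [hp0] with y h1
      rw [ENNReal.ofReal_mul h1]
    · refine ae_restrict_of_ae ?_
      filter_upwards [hp0, ae_nonneg_comp_sub hq0 r] with y h1 h2 using mul_nonneg h1 h2

variable {Ω : Type*} [MeasurableSpace Ω] {P : Measure Ω}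

theorem HasDensity.add_gammaSeries [IsFiniteMeasure P] {X Y : Ω → ℝ}
    (hα : 0 < α) (hA : 0 < A) (hB : 0 < B)
    (hp : ∀ r, 0 < r → Summable (gammaTerm α A p r))
    (hq : ∀ r, 0 < r → Summable (gammaTerm α B q r))
    (hX : HasDensity X P (gammaSeries α A p)) (hY : HasDensity Y P (gammaSeries α B q))
    (hXY : IndepFun X Y P) : HasDensity (X + Y) P (gammaSeries α (A + B) (p * q)) := by
  obtain ⟨hX1, hX2, hX3⟩ := hX
  obtain ⟨hY1, hY2, hY3⟩ := hY
  refine ⟨hXY.add_hasPDF, ae_of_all _ (gammaSeries_mul_nonneg hα hA hB hp hq hX2 hY2), ?_⟩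
  refine hXY.pdf_add_eq_lconvolution_pdf.trans (ae_of_all _ fun r => ?_)
  simp only [lconvolution_def]
  rw [← lconvolution_gammaSeries hα hA hB hp hq hX2 hY2]
  refine lintegral_congr_ae ?_
  -- The reflection `y ↦ r - y` preserves Lebesgue measure, hence carries null sets to null sets.
  filter_upwards [hX3, (Measure.measurePreserving_sub_left volume r).quasiMeasurePreserving.ae hY3]
    with y h1 h2
  rw [h1, neg_add_eq_sub, h2]

/-- The sum of independent variables with gamma series densities. -/
theorem HasDensity.sum_gammaSeries [IsFiniteMeasure P] {ι : Type*} {R : ι → Ω → ℝ}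
    (hα : 0 < α) (hA : 0 < A) (hp : ∀ r, 0 < r → Summable (gammaTerm α A p r))
    (hR : ∀ l, HasDensity (R l) P (gammaSeries α A p)) (hindep : iIndepFun R P)
    {s : Finset ι} (hs : s.Nonempty) :
    (∀ r, 0 < r → Summable (gammaTerm α (s.card * A) (p ^ s.card) r)) ∧
      HasDensity (∑ l ∈ s, R l) P (gammaSeries α (s.card * A) (p ^ s.card)) := by
  -- Summability is carried along because each further convolution needs it.
  induction hs using Finset.Nonempty.cons_induction with
  | singleton l => simpa using ⟨hp, hR l⟩
  | cons l s hl hs ih =>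
    have hc : (((Finset.cons l s hl).card : ℕ) : ℝ) * A = s.card * A + A := by
      rw [Finset.card_cons]; push_cast; ring
    have hc' : 0 < (s.card : ℝ) * A := mul_pos (Nat.cast_pos.2 hs.card_pos) hA
    rw [hc, Finset.card_cons, pow_succ, Finset.sum_cons, add_comm (R l)]
    exact ⟨fun r hr => (hasSum_gammaTerm_mul hα hc' hA ih.1 hp hr).summable,
      ih.2.add_gammaSeries hα hc' hA ih.1 hp (hR l)
        (hindep.indepFun_finsetSum_of_notMem₀ (fun i => (hR i).1.aemeasurable) hl)⟩

/-- The terms of the integrated gamma series. -/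
noncomputable def gammaPrimTerm (α A : ℝ) (p : PowerSeries ℝ) (r : ℝ) (i : ℕ) : ℝ :=
  PowerSeries.coeff i p * r ^ (α * i + A) / Real.Gamma (1 + α * i + A)

theorem gammaPrimTerm_eq (hα : 0 < α) (hA : 0 < A) {r : ℝ} (hr : 0 < r) (i : ℕ) :
    gammaPrimTerm α A p r i = gammaTerm α A p r i * (r / (α * i + A)) := by
  have h : α * i + A ≠ 0 := by positivity
  rw [gammaPrimTerm, gammaTerm, show 1 + α * i + A = α * i + A + 1 by ring, Real.Gamma_add_one h,
    Real.rpow_sub_one hr.ne']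
  field_simp

theorem integral_gammaTerm (hα : 0 < α) (hA : 0 < A) {r : ℝ} (hr : 0 < r) (i : ℕ) :
    IntegrableOn (fun y => gammaTerm α A p y i) (Ioc 0 r) ∧
      ∫ y in Ioc 0 r, gammaTerm α A p y i = gammaPrimTerm α A p r i := by
  have h : 0 < α * i + A := by positivity
  have h1 : (-1 : ℝ) < α * i + A - 1 := by linarith
  have hi := intervalIntegral.intervalIntegrable_rpow' (a := 0) (b := r) h1
  rw [intervalIntegrable_iff_integrableOn_Ioc_of_le hr.le] at hi
  have he : ∀ y, gammaTerm α A p y i =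
      PowerSeries.coeff i p / Real.Gamma (α * i + A) * y ^ (α * i + A - 1) := fun y => by
    rw [gammaTerm]; ring
  simp only [he]
  refine ⟨hi.const_mul _, ?_⟩
  rw [integral_const_mul, ← intervalIntegral.integral_of_le hr.le, integral_rpow (Or.inl h1),
    sub_add_cancel, Real.zero_rpow h.ne', gammaPrimTerm,
    show 1 + α * i + A = α * i + A + 1 by ring, Real.Gamma_add_one h.ne']
  field_simp
  ring

/-- Integration multiplies the `i`-th term by `r / (α i + A)`, which is at most `r / A`. -/
theorem summable_gammaPrimTerm (hα : 0 < α) (hA : 0 < A) {r : ℝ} (hr : 0 < r)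
    (hp : Summable (gammaTerm α A p r)) : Summable (gammaPrimTerm α A p r) := by
  refine Summable.of_norm_bounded (hp.norm.mul_right (r / A)) fun i => ?_
  rw [gammaPrimTerm_eq hα hA hr, norm_mul,
    Real.norm_of_nonneg (by positivity : 0 ≤ r / (α * i + A))]
  gcongr
  exact le_add_of_nonneg_left (by positivity)

/-- For `y > 0` the absolute value of a term is again a gamma term, with coefficient `|pᵢ|`. -/
theorem integral_norm_gammaTerm (hα : 0 < α) (hA : 0 < A) {r : ℝ} (hr : 0 < r) (i : ℕ) :
    ∫ y in Ioc 0 r, ‖gammaTerm α A p y i‖ = ‖gammaPrimTerm α A p r i‖ := by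
  have h : 0 < Real.Gamma (α * i + A) := Real.Gamma_pos_of_pos (by positivity)
  have h' : 0 < Real.Gamma (1 + α * i + A) := Real.Gamma_pos_of_pos (by positivity)
  have habs : ∀ y ∈ Ioc 0 r, ‖gammaTerm α A p y i‖ =
      gammaTerm α A (PowerSeries.mk fun n => |PowerSeries.coeff n p|) y i := fun y hy => by
    rw [gammaTerm, gammaTerm, norm_div, norm_mul, Real.norm_of_nonneg h.le,
      Real.norm_of_nonneg (Real.rpow_nonneg hy.1.le _), PowerSeries.coeff_mk, Real.norm_eq_abs]
  rw [setIntegral_congr_fun measurableSet_Ioc habs, (integral_gammaTerm hα hA hr i).2,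
    gammaPrimTerm, gammaPrimTerm, norm_div, norm_mul, Real.norm_of_nonneg h'.le,
    Real.norm_of_nonneg (Real.rpow_nonneg hr.le _), PowerSeries.coeff_mk, Real.norm_eq_abs]

theorem HasDensity.measure_le {X : Ω → ℝ} {f : ℝ → ℝ} (hX : HasDensity X P f)
    (hf : ∀ r ≤ 0, f r = 0) (r : ℝ) :
    P {ω | X ω ≤ r} = ∫⁻ y in Ioc 0 r, ENNReal.ofReal (f y) := by
  obtain ⟨h1, h2, h3⟩ := hX
  have : P {ω | X ω ≤ r} = Measure.map X P (Iic r) :=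
    (Measure.map_apply_of_aemeasurable h1.aemeasurable measurableSet_Iic).symm
  rw [this, map_eq_setLIntegral_pdf X P volume measurableSet_Iic,
    lintegral_congr_ae (ae_restrict_of_ae h3), ← lintegral_indicator measurableSet_Iic,
    ← lintegral_indicator measurableSet_Ioc]
  refine lintegral_congr fun y => ?_
  by_cases hy : 0 < y
  · simp [indicator, hy]
  · simp [indicator, hf y (not_lt.1 hy)]

theorem HasDensity.cdf_gammaSeries {X : Ω → ℝ} (hα : 0 < α) (hA : 0 < A)
    (hp : ∀ r, 0 < r → Summable (gammaTerm α A p r))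
    (hX : HasDensity X P (gammaSeries α A p)) {r : ℝ} (hr : 0 < r) :
    P.real {ω | X ω ≤ r} = ∑' i, gammaPrimTerm α A p r i := by
  have hs : Summable fun i => ∫ y in Ioc 0 r, ‖gammaTerm α A p y i‖ := by
    simp only [integral_norm_gammaTerm hα hA hr]
    exact (summable_gammaPrimTerm hα hA hr (hp r hr)).norm
  have hi := fun i => (integral_gammaTerm (p := p) hα hA hr i).1
  have hsum := integral_tsum_of_summable_integral_norm hi hs
  have hint := integrable_tsum_of_summable_integral_norm (measurable_gammaTerm α A p) hi hs
  simp only [(integral_gammaTerm hα hA hr _).2] at hsum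
  have he : ∀ y ∈ Ioc 0 r, ∑' i, gammaTerm α A p y i = gammaSeries α A p y :=
    fun y hy => (gammaSeries_of_pos hy.1).symm
  rw [hsum, setIntegral_congr_fun measurableSet_Ioc he, measureReal_def,
    hX.measure_le (fun r hr => gammaSeries_of_nonpos hr) r,
    integral_eq_lintegral_of_nonneg_ae (ae_restrict_of_ae hX.2.1)]
  exact (IntegrableOn.congr_fun hint he measurableSet_Ioc).aestronglyMeasurable

end Convolution

end AlphaMu

/-! ### Mixture densities as gamma series -/

namespace AlphaMu

/-- The coefficients of the density of an `α`-`μ` mixture as a gamma series. -/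
noncomputable def mixtureSeries (α T rhat : ℝ) (φ : ℕ → ℝ) : PowerSeries ℝ :=
  PowerSeries.C (α / rhat ^ (α * T)) * PowerSeries.mk (lam α T rhat φ)

theorem lam_zero_ne_zero {α T rhat : ℝ} (hα : 0 < α) (hT : 0 < T) {φ : ℕ → ℝ} (hφ : φ 0 ≠ 0) :
    lam α T rhat φ 0 ≠ 0 := by
  have h1 : Real.Gamma (α * T) ≠ 0 := (Real.Gamma_pos_of_pos (by positivity)).ne'
  have h2 : Real.Gamma T ≠ 0 := (Real.Gamma_pos_of_pos hT).ne'
  simp [lam, h1, h2, hφ]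

theorem coeff_mixtureSeries_pow {L : ℕ} {α T rhat : ℝ} (hrhat : 0 < rhat) {φ : ℕ → ℝ}
    (h : lam α T rhat φ 0 ≠ 0) (i : ℕ) :
    PowerSeries.coeff i (mixtureSeries α T rhat φ ^ L) =
      α ^ L / rhat ^ (α * T * L) * deltaIid L (lam α T rhat φ) i := by
  rw [mixtureSeries, mul_pow, ← map_pow, PowerSeries.coeff_C_mul, div_pow,
    deltaIid_eq_coeff_pow L _ h, Real.rpow_mul hrhat.le (α * T), Real.rpow_natCast]

theorem mixtureTerm_eq {α T rhat : ℝ} (hrhat : 0 < rhat) (φ : ℕ → ℝ) {r : ℝ} (hr : 0 < r) (i : ℕ) :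
    mixtureTerm α T rhat φ r i =
      r ^ (α * T - 1) / rhat ^ (α * T) * (φ i / Real.Gamma (i + T) * (r ^ α / rhat ^ α) ^ i) := by
  rw [mixtureTerm, show α * (i + T) - 1 = (α * T - 1) + α * i by ring, mul_add, Real.rpow_add hr,
    Real.rpow_add hrhat, Real.rpow_mul hr.le α i, Real.rpow_mul hrhat.le α i, Real.rpow_natCast,
    Real.rpow_natCast, div_pow]
  ring

/-- The factor `Γ(α (i + T))` in `λᵢ` cancels the normalisation of the gamma term; what remains is
the `i`-th Cauchy product term with `exp (-x)`, `x = r ^ α / rhat ^ α`. -/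
theorem gammaTerm_mixtureSeries {α T rhat : ℝ} (hα : 0 < α) (hT : 0 < T) (hrhat : 0 < rhat)
    (φ : ℕ → ℝ) {r : ℝ} (hr : 0 < r) (i : ℕ) :
    gammaTerm α (α * T) (mixtureSeries α T rhat φ) r i =
      α * (r ^ (α * T - 1) / rhat ^ (α * T)) *
        ∑ j ∈ Finset.range (i + 1), φ j / Real.Gamma (j + T) * (r ^ α / rhat ^ α) ^ j *
          ((-(r ^ α / rhat ^ α)) ^ (i - j) / (i - j).factorial) := by
  have hG : Real.Gamma (α * (i + T)) ≠ 0 := (Real.Gamma_pos_of_pos (by positivity)).ne'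
  have hsum : ∑ j ∈ Finset.range (i + 1), φ j / Real.Gamma (j + T) * (r ^ α / rhat ^ α) ^ j *
        ((-(r ^ α / rhat ^ α)) ^ (i - j) / (i - j).factorial) =
      (r ^ α / rhat ^ α) ^ i * ∑ j ∈ Finset.range (i + 1),
        (-1 : ℝ) ^ (i - j) * φ j / ((i - j).factorial * Real.Gamma (j + T)) := by
    rw [Finset.mul_sum]
    refine Finset.sum_congr rfl fun j hj => ?_
    rw [neg_pow (r ^ α / rhat ^ α), show (r ^ α / rhat ^ α) ^ i =
      (r ^ α / rhat ^ α) ^ j * (r ^ α / rhat ^ α) ^ (i - j) by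
        rw [← pow_add, Nat.add_sub_cancel' (Nat.lt_succ_iff.1 (Finset.mem_range.1 hj))]]
    ring
  rw [hsum, gammaTerm, mixtureSeries, PowerSeries.coeff_C_mul, PowerSeries.coeff_mk, lam,
    ← mul_add, show α * (i + T) - 1 = (α * T - 1) + α * i by ring, Real.rpow_add hr,
    Real.rpow_mul hr.le α i, Real.rpow_mul hrhat.le α i, Real.rpow_natCast,
    Real.rpow_natCast, div_pow]
  field_simp

theorem hasSum_gammaTerm_mixtureSeries {α T rhat : ℝ} (hα : 0 < α) (hT : 0 < T) (hrhat : 0 < rhat)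
    {φ : ℕ → ℝ} {r : ℝ} (hr : 0 < r) (h : Summable (mixtureTerm α T rhat φ r)) :
    HasSum (gammaTerm α (α * T) (mixtureSeries α T rhat φ) r) (mixturePDF α T rhat φ r) := by
  set x := r ^ α / rhat ^ α with hx
  have hc : 0 < r ^ (α * T - 1) / rhat ^ (α * T) :=
    div_pos (Real.rpow_pos_of_pos hr _) (Real.rpow_pos_of_pos hrhat _)
  have hterm : mixtureTerm α T rhat φ r = fun i : ℕ =>
      r ^ (α * T - 1) / rhat ^ (α * T) * (φ i / Real.Gamma (i + T) * x ^ i) :=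
    funext fun i => mixtureTerm_eq hrhat φ hr i
  have hs : Summable fun i : ℕ => φ i / Real.Gamma (i + T) * x ^ i := by
    rw [hterm] at h
    exact (summable_mul_left_iff hc.ne').1 h
  have he : HasSum (fun n : ℕ => (-x) ^ n / n.factorial) (Real.exp (-x)) := by
    rw [Real.exp_eq_exp_ℝ]
    exact NormedSpace.expSeries_div_hasSum_exp (-x)
  have hprod := (hasSum_sum_range_mul_of_summable_norm hs.norm he.summable.norm).mul_left
    (α * (r ^ (α * T - 1) / rhat ^ (α * T)))
  rw [he.tsum_eq] at hprod
  rw [mixturePDF, if_pos hr, ← hx, hterm, tsum_mul_left, funext fun i =>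
    gammaTerm_mixtureSeries hα hT hrhat φ hr i]
  have hval : ∀ a b c d : ℝ, a * b * (c * d) = a * c * (d * b) := fun a b c d => by ring
  rw [hval]
  exact hprod

theorem IsMixture.hasDensity_gammaSeries {Ω : Type*} [MeasurableSpace Ω] {P : Measure Ω}
    {X : Ω → ℝ} {α T rhat : ℝ} (hα : 0 < α) (hT : 0 < T) (hrhat : 0 < rhat) {φ : ℕ → ℝ}
    (hX : IsMixture X P α T rhat φ) :
    HasDensity X P (gammaSeries α (α * T) (mixtureSeries α T rhat φ)) := by
  convert hX.2 using 1
  ext r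
  rcases le_or_gt r 0 with hr | hr
  · rw [gammaSeries_of_nonpos hr, mixturePDF, if_neg hr.not_gt]
  · rw [gammaSeries_of_pos hr, (hasSum_gammaTerm_mixtureSeries hα hT hrhat hr (hX.1 r hr)).tsum_eq]

theorem gammaTerm_mixtureSeries_pow {L : ℕ} {α T rhat : ℝ} (hrhat : 0 < rhat) {φ : ℕ → ℝ}
    (h : lam α T rhat φ 0 ≠ 0) (r : ℝ) (i : ℕ) :
    gammaTerm α (L * (α * T)) (mixtureSeries α T rhat φ ^ L) r i =
      α ^ L / rhat ^ (α * T * L) * pdfTermIid L α T rhat φ r i := by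
  rw [gammaTerm, coeff_mixtureSeries_pow hrhat h, pdfTermIid,
    show α * i + L * (α * T) - 1 = -1 + α * i + α * L * T by ring,
    show α * i + L * (α * T) = i * α + α * L * T by ring]
  ring

theorem gammaPrimTerm_mixtureSeries_pow {L : ℕ} {α T rhat : ℝ} (hrhat : 0 < rhat) {φ : ℕ → ℝ}
    (h : lam α T rhat φ 0 ≠ 0) (r : ℝ) (i : ℕ) :
    gammaPrimTerm α (L * (α * T)) (mixtureSeries α T rhat φ ^ L) r i =
      α ^ L / rhat ^ (α * T * L) * cdfTermIid L α T rhat φ r i := by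
  rw [gammaPrimTerm, coeff_mixtureSeries_pow hrhat h, cdfTermIid,
    show 1 + α * i + L * (α * T) = 1 + i * α + α * L * T by ring,
    show α * i + L * (α * T) = α * i + α * L * T by ring]
  ring

theorem cdfTermIid_zero {L : ℕ} (hL : 1 ≤ L) {α T : ℝ} (hα : 0 < α) (hT : 0 < T) (rhat : ℝ)
    (φ : ℕ → ℝ) : cdfTermIid L α T rhat φ 0 = 0 := by
  ext i
  have hL' : (0 : ℝ) < L := Nat.cast_pos.2 hL
  have : α * i + α * L * T ≠ 0 := by positivity
  simp [cdfTermIid, Real.zero_rpow this]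

end AlphaMu

theorem corollary2 {Ω : Type*} [MeasurableSpace Ω] (P : Measure Ω) [IsProbabilityMeasure P]
    (L : ℕ) (hL : 1 ≤ L) (α T rhat : ℝ) (hα : 0 < α) (hT : 0 < T) (hrhat : 0 < rhat)
    (φ : ℕ → ℝ) (hφ : φ 0 ≠ 0) (R : Fin L → Ω → ℝ)
    (hindep : iIndepFun R P) (hR : ∀ l, AlphaMu.IsMixture (R l) P α T rhat φ) :
    -- the series converge absolutely, and are the PDF and the CDF of the sum
    (∀ r : ℝ, 0 < r → Summable (AlphaMu.pdfTermIid L α T rhat φ r)) ∧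
    AlphaMu.HasDensity (fun ω => ∑ l, R l ω) P
      (fun r => if 0 < r then AlphaMu.pdfIid L α T rhat φ r else 0) ∧
    (∀ r : ℝ, 0 ≤ r → Summable (AlphaMu.cdfTermIid L α T rhat φ r) ∧
      P.real {ω | ∑ l, R l ω ≤ r} = AlphaMu.cdfIid L α T rhat φ r) ∧
    (∀ r : ℝ, r < 0 → P.real {ω | ∑ l, R l ω ≤ r} = 0) ∧
    -- the general formulas reduce to these ones
    (∀ i : ℕ, AlphaMu.deltaInid (fun _ : Fin L => AlphaMu.lam α T rhat φ) i =
      AlphaMu.deltaIid L (AlphaMu.lam α T rhat φ) i) ∧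
    (∀ r : ℝ, 0 < r → AlphaMu.pdfInid α (fun _ : Fin L => T) (fun _ => rhat) (fun _ => φ) r =
      AlphaMu.pdfIid L α T rhat φ r) ∧
    (∀ r : ℝ, 0 ≤ r → AlphaMu.cdfInid α (fun _ : Fin L => T) (fun _ => rhat) (fun _ => φ) r =
      AlphaMu.cdfIid L α T rhat φ r) := by
  open AlphaMu in
  have hlam : lam α T rhat φ 0 ≠ 0 := lam_zero_ne_zero hα hT hφ
  have : Nonempty (Fin L) := ⟨⟨0, hL⟩⟩
  have hc : α ^ L / rhat ^ (α * T * L) ≠ 0 :=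
    (div_pos (pow_pos hα _) (Real.rpow_pos_of_pos hrhat _)).ne'
  have hA : 0 < (L : ℝ) * (α * T) := mul_pos (Nat.cast_pos.2 hL) (mul_pos hα hT)
  obtain ⟨hsum, hdens⟩ := HasDensity.sum_gammaSeries hα (mul_pos hα hT)
    (fun r hr => (hasSum_gammaTerm_mixtureSeries hα hT hrhat hr
      ((hR (Classical.arbitrary _)).1 r hr)).summable)
    (fun l => (hR l).hasDensity_gammaSeries hα hT hrhat) hindep Finset.univ_nonempty
  rw [Finset.card_univ, Fintype.card_fin] at hsum hdens
  rw [show ∑ l, R l = fun ω => ∑ l, R l ω from funext fun ω => Finset.sum_apply _ _ _] at hdens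
  have hle0 : ∀ r : ℝ, r ≤ 0 → P.real {ω | ∑ l, R l ω ≤ r} = 0 := fun r hr => by
    rw [measureReal_def, hdens.measure_le (fun r hr => gammaSeries_of_nonpos hr) r,
      Set.Ioc_eq_empty hr.not_gt]
    simp
  refine ⟨fun r hr => ?_, ?_, fun r hr => ?_, fun r hr => hle0 r hr.le, deltaInid_const L _ hlam,
    fun r _ => pdfInid_const L α T rhat hrhat φ hlam r,
    fun r _ => cdfInid_const L α T rhat hrhat φ hlam r⟩
  · have := hsum r hr
    rw [funext (gammaTerm_mixtureSeries_pow hrhat hlam r)] at this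
    exact (summable_mul_left_iff hc).1 this
  · convert hdens using 2 with r
    rw [gammaSeries, funext (gammaTerm_mixtureSeries_pow hrhat hlam r), tsum_mul_left, pdfIid]
  -- At `r = 0` every exponent `α i + α L T` is positive, so all terms vanish, as does the
  -- probability.
  · rcases hr.eq_or_lt with rfl | hr
    · rw [hle0 0 le_rfl, cdfIid, cdfTermIid_zero hL hα hT]
      exact ⟨summable_zero, by simp⟩
    · have h := summable_gammaPrimTerm hα hA hr (hsum r hr)
      rw [hdens.cdf_gammaSeries hα hA hsum hr]
      rw [funext (gammaPrimTerm_mixtureSeries_pow hrhat hlam r)] at h ⊢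
      exact ⟨(summable_mul_left_iff hc).1 h, by rw [tsum_mul_left, cdfIid]⟩
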